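/- Let $m\ge 2$ be an integer, let $|\cdot|$ be the Euclidean norm on $\mathbb R^m$, $\mathbb S=\{x\in\mathbb R^m: |x|=1\}$, $\mathbb B=\{x\in\mathbb R^m: |x|<1\}$, and let $\rho\ge 0$ be a real number. A function $h:\mathbb S\to[-\infty,+\infty)$ is called $\rho$-subspherical if either $\rho=0$ and $h$ is constant, or $\rho>0$ and either $h\equiv-\infty$ or the function $H(x)=|x|^{\rho}h(x/|x|)$ for $x\ne 0$, $H(0)=0$, is subharmonic on $\mathbb R^m$. For a bounded domain $D\subset\mathbb R^m$, a compact set $S\subset D$ and $b\ge 0$, let $\mathrm{sbh}_0^+(D\setminus S;\le b)$ denote the class of (positive) subharmonic test functions on $D$ outside $S$ bounded by $b$, that is, of the functions $v:D\setminus S\to[0,+\infty)$ that are subharmonic on $D\setminus S$, satisfy $v\le b$ on $D\setminus S$, and satisfy $v(x)\to 0$ as $x\to z$, $x\in D\setminus S$, for every $z\in\partial D$. Let $h\ge 0$ be a $\rho$-subspherical function on $\mathbb S$, and let $g:[0,+\infty)\to[0,+\infty)$ be a convex function with $g(0)=0$. Put $$r_\rho=\max\Bigl\{\tfrac12,\ \Bigl(\Bigl(1-\frac{m-1}{\rho(\rho+m-2)}\Bigr)^{+}\Bigr)^{1/(m-1)}\Bigr\}\quad(\rho>0),\qquad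 r_0=\tfrac12,$$ where $a^+=\max\{0,a\}$. Then $\frac12\le r_\rho<1$, $h$ attains its maximum on $\mathbb S$, and the function $$x\mapsto g\Bigl(\frac1{|x|^{m-1}}-1\Bigr)\,h\bigl(x/|x|\bigr)$$ belongs to the class $$\mathrm{sbh}_0^+\bigl(\mathbb B\setminus r_\rho\overline{\mathbb B};\ \le b_\rho\bigr),\qquad b_\rho=g\Bigl(\frac1{r_\rho^{m-1}}-1\Bigr)\max_{\mathbb S}h,$$ where $\overline{\mathbb B}$ is the closed unit ball and $r_\rho\overline{\mathbb B}=\{x: |x|\le r_\rho\}$. -/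

import Mathlib

open Set Metric Filter Topology

noncomputable section

/-- The Euclidean space `ℝ^m` with its Euclidean norm. -/
abbrev Euc (m : ℕ) : Type := EuclideanSpace ℝ (Fin m)

/-- The unit sphere of `ℝ^m`. -/
abbrev UnitSphere (m : ℕ) : Type := sphere (0 : Euc m) 1

/-- The point `x / |x|` of the unit sphere, for `x ≠ 0`. -/
def sphereDir {m : ℕ} (x : Euc m) (hx : x ≠ 0) : UnitSphere m :=
  ⟨‖x‖⁻¹ • x, by simp [norm_smul, hx]⟩

/-- `u` is subharmonic on the open set `U ⊆ ℝ^m`, with values in `[-∞, +∞)`: it is upper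
semicontinuous on `U`, and on every closed ball in `U` it is dominated by each function that is
continuous on the closed ball, harmonic in the open ball and dominates `u` on the bounding sphere.
The function `u ≡ -∞` is allowed. Values of `u` outside `U` play no role. -/
structure SubharmonicOn {m : ℕ} (u : Euc m → EReal) (U : Set (Euc m)) : Prop where
  lt_top : ∀ x ∈ U, u x < ⊤
  usc : UpperSemicontinuousOn u U
  le_of_harmonic : ∀ (c : Euc m) (r : ℝ), 0 < r → closedBall c r ⊆ U →
    ∀ φ : Euc m → ℝ,
      InnerProductSpace.HarmonicContOnCl φ (ball c r) →
      (∀ y ∈ sphere c r, u y ≤ (φ y : EReal)) →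
      ∀ y ∈ ball c r, u y ≤ (φ y : EReal)

open Classical in
/-- The positively homogeneous extension of order `ρ`: `H(x) = |x|^ρ h(x/|x|)` for `x ≠ 0`, and
`H(0) = 0`. -/
def homogExt {m : ℕ} (ρ : ℝ) (h : UnitSphere m → EReal) (x : Euc m) : EReal :=
  if hx : x = 0 then 0 else ((‖x‖ ^ ρ : ℝ) : EReal) * h (sphereDir x hx)

/-- The class of `ρ`-subspherical functions `h` with values in `[-∞, +∞)` on the unit sphere of
`ℝ^m`, for `ρ ≥ 0`. For `ρ = 0` these are the constants in `[-∞, +∞)`; for `ρ > 0` they are the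
function `h ≡ -∞` and the functions whose homogeneous extension of order `ρ` is subharmonic in
the whole space. -/
def IsSubspherical {m : ℕ} (ρ : ℝ) (h : UnitSphere m → EReal) : Prop :=
  (ρ = 0 ∧ ∃ c : EReal, c ≠ ⊤ ∧ ∀ s, h s = c) ∨
  (0 < ρ ∧ ((∀ s, h s = ⊥) ∨ SubharmonicOn (homogExt ρ h) univ))

/-- The class of nonnegative subharmonic test functions on the bounded domain `D ⊆ ℝ^m` outside
of the compact set `S ⊆ D` with bound `b`: functions that are subharmonic on `D \ S`, nonnegative
there, tend to `0` at each boundary point of `D`, and are at most `b` on `D \ S`. -/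
structure IsSubharmonicTest {m : ℕ} (D S : Set (Euc m)) (b : ℝ) (v : Euc m → ℝ) : Prop where
  subharmonic : SubharmonicOn (fun x => (v x : EReal)) (D \ S)
  nonneg : ∀ x ∈ D \ S, 0 ≤ v x
  tendsto_zero : ∀ z ∈ frontier D, Tendsto v (𝓝[D \ S] z) (𝓝 0)
  le_bound : ∀ x ∈ D \ S, v x ≤ b

open Classical in
/-- The radius `r_ρ = max {1/2, ((1 - (m-1)/(ρ(ρ+m-2)))⁺)^(1/(m-1))}`. For `ρ = 0` the quotient is
read as `+∞`, so that the positive part vanishes and `r_0 = 1/2`. -/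
def critRadius (m : ℕ) (ρ : ℝ) : ℝ :=
  if ρ = 0 then 1 / 2
  else max (1 / 2)
    ((max 0 (1 - ((m : ℝ) - 1) / (ρ * (ρ + (m : ℝ) - 2)))) ^ (1 / ((m : ℝ) - 1)))

open Classical in
/-- The function `x ↦ g(1/|x|^(m-1) - 1) h(x/|x|)` for `x ≠ 0` (the value at `0` is irrelevant). -/
def radialTest {m : ℕ} (g : ℝ → ℝ) (h : UnitSphere m → ℝ) (x : Euc m) : ℝ :=
  if hx : x = 0 then 0 else g (1 / ‖x‖ ^ (m - 1) - 1) * h (sphereDir x hx)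

end

/-!
# Subharmonic test functions near the unit sphere built from subspherical functions

For smooth `h` and `g` one computes in polar coordinates, with `f(r) = g(r^(1-m) - 1)`,
`Δ(f h) = (f'' + (m-1) f'/r) h + r⁻² f Δ_S h`. Subharmonicity of `|x|^ρ h(x/|x|)` says
`Δ_S h ≥ -ρ(ρ+m-2) h`, and convexity of `g` with `g 0 = 0` gives `g(t) ≤ t g'(t)`, so that
`Δ(f h) ≥ 0` as soon as `ρ(ρ+m-2)(1 - r^(m-1)) ≤ m - 1`, which is the condition `r ≥ r_ρ`.

Neither `h` nor `g` is smooth, so the computation is carried out on test functions.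

* A `C²` function touching a subharmonic function from above has nonnegative Laplacian at the
  contact point (`SubharmonicOn.bilinTrace_nonneg`); the Dirichlet problem is needed only for
  quadratic polynomials on balls, where its solution is explicit. Conversely an upper
  semicontinuous function with this property is subharmonic (`subharmonicOn_of_touching`), by
  looking at an interior maximum of `v - φ + ε |x - c|²`.
* If `ψ` touches `v = g(|x|^(1-m) - 1) h` from above at `x₀`, replace `g` by an affine minorant
  touching it at the corresponding point; `v` becomes `F h` with `F = c + p |x|^(1-m)`, and `ψ`
  still touches it from above. If `F(x₀) > 0`, then `|x|^ρ ψ / F` touches `H = |x|^ρ h` from above.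
  The function `w = ψ - h(x₀/|x₀|) F` vanishes at `x₀` together with its radial derivative, so no
  cross terms appear in the Laplacian of the product `(|x|^ρ / F) w`, and the condition
  `Δ(|x|^ρ ψ / F) ≥ 0` at `x₀` is exactly the inequality obtained above by formal differentiation
  (`bilinTrace_ge_of_touching`). If `F(x₀) = 0`, or if `h` is constant, then `ψ`, respectively `w`,
  has a local minimum at `x₀`.

First and second derivatives are handled through the predicate `HasSecondFDerivAt`, and the
Laplacian is the trace of the second derivative (`HasSecondFDerivAt.laplacian_eq`).
-/

/-! ### Second derivatives, their traces, and the Laplacian -/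

/-- `f` is differentiable near `x`, and its derivative, which equals `l` at `x`, is differentiable
at `x` with derivative `B`. -/
def HasSecondFDerivAt {m : ℕ} (f : Euc m → ℝ) (l : Euc m →L[ℝ] ℝ)
    (B : Euc m →L[ℝ] Euc m →L[ℝ] ℝ) (x : Euc m) : Prop :=
  ∃ f' : Euc m → Euc m →L[ℝ] ℝ,
    (∀ᶠ y in 𝓝 x, HasFDerivAt f (f' y) y) ∧ f' x = l ∧ HasFDerivAt f' B x

/-- The trace of a bilinear form on `ℝ^m` in the standard basis. -/
noncomputable def bilinTrace {m : ℕ} (B : Euc m →L[ℝ] Euc m →L[ℝ] ℝ) : ℝ :=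
  ∑ i, B (EuclideanSpace.basisFun (Fin m) ℝ i) (EuclideanSpace.basisFun (Fin m) ℝ i)

section
variable {m : ℕ} {f g : Euc m → ℝ} {l k : Euc m →L[ℝ] ℝ} {B C : Euc m →L[ℝ] Euc m →L[ℝ] ℝ}
  {x : Euc m}

theorem bilinTrace_zero : bilinTrace (0 : Euc m →L[ℝ] Euc m →L[ℝ] ℝ) = 0 := by
  simp [bilinTrace]

theorem bilinTrace_add (B C : Euc m →L[ℝ] Euc m →L[ℝ] ℝ) :
    bilinTrace (B + C) = bilinTrace B + bilinTrace C := by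
  simp [bilinTrace, Finset.sum_add_distrib]

theorem bilinTrace_smul (c : ℝ) (B : Euc m →L[ℝ] Euc m →L[ℝ] ℝ) :
    bilinTrace (c • B) = c * bilinTrace B := by
  simp [bilinTrace, Finset.mul_sum]

theorem bilinTrace_flip (B : Euc m →L[ℝ] Euc m →L[ℝ] ℝ) :
    bilinTrace B.flip = bilinTrace B := by
  simp [bilinTrace]

theorem bilinTrace_innerSL : bilinTrace (innerSL ℝ (E := Euc m)) = m := by
  have h : ∀ i, innerSL ℝ (EuclideanSpace.basisFun (Fin m) ℝ i)
      (EuclideanSpace.basisFun (Fin m) ℝ i) = 1 := fun i => by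
    rw [innerSL_apply_apply, real_inner_self_eq_norm_sq]
    simp
  exact (Finset.sum_congr rfl fun i _ => h i).trans (by simp)

theorem bilinTrace_smulRight (l k : Euc m →L[ℝ] ℝ) :
    bilinTrace (l.smulRight k) =
      ∑ i, l (EuclideanSpace.basisFun (Fin m) ℝ i) * k (EuclideanSpace.basisFun (Fin m) ℝ i) := by
  simp [bilinTrace]

theorem bilinTrace_smulRight_innerSL_left (x : Euc m) (k : Euc m →L[ℝ] ℝ) :
    bilinTrace ((innerSL ℝ x).smulRight k) = k x := by
  rw [bilinTrace_smulRight]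
  conv_rhs => rw [← (EuclideanSpace.basisFun (Fin m) ℝ).sum_repr x]
  simp [map_sum, EuclideanSpace.inner_single_right]

theorem bilinTrace_smulRight_comm (l k : Euc m →L[ℝ] ℝ) :
    bilinTrace (l.smulRight k) = bilinTrace (k.smulRight l) := by
  simp only [bilinTrace_smulRight, mul_comm]

theorem norm_sq_rpow_half (y : Euc m) (r : ℝ) : (‖y‖ ^ 2) ^ (r / 2) = ‖y‖ ^ r := by
  rw [← Real.rpow_natCast, ← Real.rpow_mul (norm_nonneg y)]
  congr 1
  push_cast
  ring

namespace HasSecondFDerivAt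

theorem hasFDerivAt (hf : HasSecondFDerivAt f l B x) : HasFDerivAt f l x := by
  obtain ⟨f', h1, rfl, -⟩ := hf
  exact h1.self_of_nhds

theorem const (c : ℝ) (x : Euc m) : HasSecondFDerivAt (fun _ => c) 0 0 x :=
  ⟨fun _ => 0, Eventually.of_forall fun y => hasFDerivAt_const c y, rfl, hasFDerivAt_const 0 x⟩

theorem add (hf : HasSecondFDerivAt f l B x) (hg : HasSecondFDerivAt g k C x) :
    HasSecondFDerivAt (fun y => f y + g y) (l + k) (B + C) x := by
  obtain ⟨f', h1, rfl, h3⟩ := hf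
  obtain ⟨g', h4, rfl, h6⟩ := hg
  refine ⟨fun y => f' y + g' y, ?_, rfl, h3.add h6⟩
  filter_upwards [h1, h4] with y hy hy'
  exact hy.add hy'

theorem mul (hf : HasSecondFDerivAt f l B x) (hg : HasSecondFDerivAt g k C x) :
    HasSecondFDerivAt (fun y => f y * g y) (f x • k + g x • l)
      ((f x • C + l.smulRight k) + (g x • B + k.smulRight l)) x := by
  have hf0 := hf.hasFDerivAt
  have hg0 := hg.hasFDerivAt
  obtain ⟨f', h1, rfl, h3⟩ := hf
  obtain ⟨g', h4, rfl, h6⟩ := hg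
  refine ⟨fun y => f y • g' y + g y • f' y, ?_, rfl, (hf0.smul h6).add (hg0.smul h3)⟩
  filter_upwards [h1, h4] with y hy hy'
  exact hy.mul hy'

theorem const_mul (c : ℝ) (hf : HasSecondFDerivAt f l B x) :
    HasSecondFDerivAt (fun y => c * f y) (c • l) (c • B) x := by
  obtain ⟨f', h1, rfl, h3⟩ := hf
  refine ⟨fun y => c • f' y, ?_, rfl, h3.const_smul c⟩
  filter_upwards [h1] with y hy
  exact hy.const_mul c

theorem clm (l : Euc m →L[ℝ] ℝ) (z x : Euc m) : HasSecondFDerivAt (fun y => l (y - z)) l 0 x := by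
  refine ⟨fun _ => l, Eventually.of_forall fun y => ?_, rfl, hasFDerivAt_const l x⟩
  exact (l.hasFDerivAt (x := y - z)).comp y ((hasFDerivAt_id y).sub_const z)

theorem bilin (B : Euc m →L[ℝ] Euc m →L[ℝ] ℝ) (z x : Euc m) :
    HasSecondFDerivAt (fun y => B (y - z) (y - z)) ((B + B.flip) (x - z)) (B + B.flip) x := by
  refine ⟨fun y => (B + B.flip) (y - z), Eventually.of_forall fun y => ?_, rfl,
    ((B + B.flip).hasFDerivAt (x := x - z)).comp x ((hasFDerivAt_id x).sub_const z)⟩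
  have h : HasFDerivAt (fun y => y - z) (ContinuousLinearMap.id ℝ (Euc m)) y :=
    (hasFDerivAt_id y).sub_const z
  refine (((B.hasFDerivAt (x := y - z)).comp y h).clm_apply h).congr_fderiv ?_
  ext v
  simp

/-- A function of `‖x‖²` with profile `α`: the gradient points along `x`, and the Laplacian is
`4 α'' ‖x‖² + 2 m α'`. -/
theorem comp_norm_sq {α α' : ℝ → ℝ} {α'' : ℝ}
    (h : ∀ᶠ s in 𝓝 (‖x‖ ^ 2), HasDerivAt α (α' s) s) (h' : HasDerivAt α' α'' (‖x‖ ^ 2)) :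
    ∃ B, HasSecondFDerivAt (fun y => α (‖y‖ ^ 2)) ((2 * α' (‖x‖ ^ 2)) • innerSL ℝ x) B x ∧
      bilinTrace B = 4 * α'' * ‖x‖ ^ 2 + 2 * m * α' (‖x‖ ^ 2) := by
  have hn : ∀ y : Euc m, HasFDerivAt (fun y : Euc m => ‖y‖ ^ 2) (2 • innerSL ℝ y) y := fun y =>
    (hasStrictFDerivAt_norm_sq y).hasFDerivAt
  have h2 : HasFDerivAt (fun y : Euc m => 2 * α' (‖y‖ ^ 2)) ((2 * α'') • (2 • innerSL ℝ x)) x := by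
    have := (h'.comp_hasFDerivAt x (hn x)).const_mul 2
    simpa [smul_smul, mul_comm, mul_assoc] using this
  refine ⟨_, ⟨fun y => (2 * α' (‖y‖ ^ 2)) • innerSL ℝ y, ?_, rfl,
    h2.smul (innerSL ℝ (E := Euc m)).hasFDerivAt⟩, ?_⟩
  · have hc : Tendsto (fun y : Euc m => ‖y‖ ^ 2) (𝓝 x) (𝓝 (‖x‖ ^ 2)) :=
      (hn x).continuousAt
    filter_upwards [hc.eventually h] with y hy
    have := hy.comp_hasFDerivAt y (hn y)
    refine this.congr_fderiv ?_
    ext v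
    simp
    ring
  · rw [bilinTrace_add, bilinTrace_smul, bilinTrace_innerSL]
    have : ((2 * α'') • (2 • innerSL ℝ x) : Euc m →L[ℝ] ℝ).smulRight (innerSL ℝ x) =
      (4 * α'') • (innerSL ℝ x).smulRight (innerSL ℝ x) := by
      ext u v
      simp
      ring
    rw [this, bilinTrace_smul, bilinTrace_smulRight_innerSL_left]
    simp
    ring

/-- The Laplacian of `‖x‖^s` is `s (s + m - 2) ‖x‖^(s - 2)`. -/
theorem norm_rpow (s : ℝ) (hx : x ≠ 0) :
    ∃ (c : ℝ) (B : _), HasSecondFDerivAt (fun y => ‖y‖ ^ s) (c • innerSL ℝ x) B x ∧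
      bilinTrace B = s * (s + m - 2) * ‖x‖ ^ (s - 2) := by
  have hx0 : 0 < ‖x‖ := norm_pos_iff.2 hx
  have h1 : ∀ᶠ t in 𝓝 (‖x‖ ^ 2), HasDerivAt (fun t : ℝ => t ^ (s / 2))
      (s / 2 * t ^ (s / 2 - 1)) t := by
    filter_upwards [eventually_ne_nhds (by positivity : ‖x‖ ^ 2 ≠ 0)] with t ht
    exact Real.hasDerivAt_rpow_const (Or.inl ht)
  have h2 : HasDerivAt (fun t : ℝ => s / 2 * t ^ (s / 2 - 1))
      (s / 2 * ((s / 2 - 1) * (‖x‖ ^ 2) ^ (s / 2 - 1 - 1))) (‖x‖ ^ 2) :=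
    (Real.hasDerivAt_rpow_const (Or.inl (by positivity))).const_mul _
  obtain ⟨B, hB, htr⟩ := comp_norm_sq h1 h2
  simp only [norm_sq_rpow_half] at hB
  refine ⟨_, B, hB, htr.trans ?_⟩
  rw [show s / 2 - 1 = (s - 2) / 2 by ring, norm_sq_rpow_half,
    show (s - 2) / 2 - 1 = (s - 2 - 2) / 2 by ring, norm_sq_rpow_half]
  have : ‖x‖ ^ (s - 2) = ‖x‖ ^ (s - 2 - 2) * ‖x‖ ^ 2 := by
    rw [← Real.rpow_natCast ‖x‖ 2, ← Real.rpow_add hx0]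
    congr 1
    push_cast
    ring
  rw [this]
  ring

theorem _root_.ContDiffAt.hasSecondFDerivAt (hf : ContDiffAt ℝ 2 f x) :
    HasSecondFDerivAt f (fderiv ℝ f x) (fderiv ℝ (fderiv ℝ f) x) x := by
  refine ⟨fderiv ℝ f, ?_, rfl, ?_⟩
  · filter_upwards [hf.eventually (by simp)] with y hy
    exact (hy.differentiableAt (by simp)).hasFDerivAt
  · exact ((hf.fderiv_right (m := 1) (by norm_num)).differentiableAt (by simp)).hasFDerivAt

open InnerProductSpace Laplacian in
theorem laplacian_eq (hf : HasSecondFDerivAt f l B x) : Δ f x = bilinTrace B := by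
  obtain ⟨f', h1, -, h3⟩ := hf
  have h : fderiv ℝ f =ᶠ[𝓝 x] f' := by
    filter_upwards [h1] with y hy using hy.fderiv
  rw [laplacian_eq_iteratedFDeriv_orthonormalBasis f (EuclideanSpace.basisFun (Fin m) ℝ)]
  simp only [bilinTrace, iteratedFDeriv_two_apply, h.fderiv_eq, h3.fderiv]
  simp

/-- Second-order Taylor expansion as a two-sided bound. -/
theorem taylor_bound (hf : HasSecondFDerivAt f l B x) {ε : ℝ} (hε : 0 < ε) :
    ∃ δ > 0, ∀ y, ‖y‖ < δ → |f (x + y) - f x - l y - B y y / 2| ≤ ε * ‖y‖ ^ 2 := by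
  obtain ⟨f', h1, rfl, h3⟩ := hf
  have h4 := (hasFDerivAt_iff_isLittleO_nhds_zero.1 h3).def hε
  have h5 : ∀ᶠ y in 𝓝 (0 : Euc m), HasFDerivAt f (f' (x + y)) (x + y) := by
    have : Tendsto (fun y => x + y) (𝓝 (0 : Euc m)) (𝓝 x) := by
      simpa using (continuous_const.add continuous_id).tendsto (f := fun y => x + y) (0 : Euc m)
    exact this.eventually h1
  obtain ⟨δ, hδ, H⟩ := Metric.eventually_nhds_iff_ball.1 (h4.and h5)
  refine ⟨δ, hδ, fun y hy => ?_⟩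
  -- the remainder along the segment from `x` to `x + y`; its derivative is uniformly small, and
  -- this needs no symmetry of `B`
  set R : ℝ → ℝ := fun t => f (x + t • y) - t * f' x y - t ^ 2 * (B y y / 2) with hR
  have hmem : ∀ t ∈ Icc (0 : ℝ) 1, t • y ∈ ball (0 : Euc m) δ := fun t ht => by
    rw [mem_ball_zero_iff, norm_smul, Real.norm_of_nonneg ht.1]
    nlinarith [ht.2, norm_nonneg y]
  have hd : ∀ t ∈ Icc (0 : ℝ) 1, HasDerivWithinAt R
      (f' (x + t • y) y - f' x y - t * B y y) (Icc 0 1) t := fun t ht => by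
    have hc : HasDerivAt (fun t : ℝ => x + t • y) y t := by
      simpa using ((hasDerivAt_id t).smul_const y).const_add x
    have h6 := ((H _ (hmem t ht)).2.comp_hasDerivAt t hc)
    have h7 := (h6.sub ((hasDerivAt_id t).mul_const (f' x y))).sub
      (((hasDerivAt_id t).pow 2).mul_const (B y y / 2))
    refine (h7.congr_deriv ?_).hasDerivWithinAt
    simp
    ring
  have hb : ∀ t ∈ Icc (0 : ℝ) 1, ‖f' (x + t • y) y - f' x y - t * B y y‖ ≤ ε * ‖y‖ ^ 2 :=
    fun t ht => by
      have h8 := (H _ (hmem t ht)).1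
      have h9 := (f' (x + t • y) - f' x - B (t • y)).le_opNorm y
      have h10 : (f' (x + t • y) - f' x - B (t • y)) y = f' (x + t • y) y - f' x y - t * B y y := by
        simp
      rw [← h10]
      refine h9.trans ?_
      rw [norm_smul, Real.norm_of_nonneg ht.1] at h8
      have : ε * (t * ‖y‖) ≤ ε * ‖y‖ := by
        have := mul_le_mul_of_nonneg_right ht.2 (norm_nonneg y)
        nlinarith
      nlinarith [mul_le_mul_of_nonneg_right (h8.trans this) (norm_nonneg y)]
  have := (convex_Icc (0 : ℝ) 1).norm_image_sub_le_of_norm_hasDerivWithin_le hd hb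
    (left_mem_Icc.2 zero_le_one) (right_mem_Icc.2 zero_le_one)
  simp only [hR, one_smul, zero_smul, add_zero, Real.norm_eq_abs] at this
  convert this using 1
  · congr 1
    ring
  · simp

theorem bilinTrace_nonneg_of_isLocalMin (hf : HasSecondFDerivAt f l B x) (h : IsLocalMin f x) :
    0 ≤ bilinTrace B := by
  have hl : l = 0 := h.hasFDerivAt_eq_zero hf.hasFDerivAt
  subst hl
  refine Finset.sum_nonneg fun i _ => ?_
  set e := EuclideanSpace.basisFun (Fin m) ℝ i
  have he : ‖e‖ = 1 := (EuclideanSpace.basisFun (Fin m) ℝ).norm_eq_one i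
  refine le_of_forall_pos_le_add fun ε hε => ?_
  obtain ⟨δ, hδ, H⟩ := hf.taylor_bound (half_pos hε)
  obtain ⟨δ', hδ', H'⟩ := Metric.eventually_nhds_iff.1 h
  set s := min δ δ' / 2
  have hs : 0 < s := by positivity
  have hn : ‖s • e‖ = s := by rw [norm_smul, he, Real.norm_of_nonneg hs.le, mul_one]
  have h1 := H (s • e) (by rw [hn]; have := min_le_left δ δ'; simp only [s]; linarith)
  have h2 := H' (y := x + s • e) (by
    rw [dist_self_add_left, hn]; have := min_le_right δ δ'; simp only [s]; linarith)
  have h3 := (abs_le.1 h1).2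
  rw [hn] at h3
  simp only [map_smul, smul_apply, smul_eq_mul,
    zero_apply] at h3
  have h4 : 0 ≤ s ^ 2 * (B e e + ε) := by nlinarith
  exact nonneg_of_mul_nonneg_right h4 (by positivity)

end HasSecondFDerivAt

end

/-! ### Subharmonicity and test functions touching from above -/

section
variable {m : ℕ} {l : Euc m →L[ℝ] ℝ} {B : Euc m →L[ℝ] Euc m →L[ℝ] ℝ} {x : Euc m}

open InnerProductSpace in
/-- A quadratic polynomial whose second-order part has zero trace is harmonic. -/
theorem harmonicOnNhd_quadratic (c : ℝ) (l : Euc m →L[ℝ] ℝ) {B : Euc m →L[ℝ] Euc m →L[ℝ] ℝ}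
    (hB : bilinTrace B = 0) (z : Euc m) (U : Set (Euc m)) :
    HarmonicOnNhd (fun y => c + l (y - z) + 1 / 2 * B (y - z) (y - z)) U := by
  intro x _
  constructor
  · have h : ContDiff ℝ 2 (fun y : Euc m => y - z) := contDiff_id.sub contDiff_const
    exact ((contDiff_const.add (l.contDiff.comp h)).add
      (contDiff_const.mul ((B.contDiff.comp h).clm_apply h))).contDiffAt
  · refine Eventually.of_forall fun y => ?_
    have h := ((HasSecondFDerivAt.const c y).add (.clm l z y)).add
      ((HasSecondFDerivAt.bilin B z y).const_mul (1 / 2))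
    rw [h.laplacian_eq]
    rw [bilinTrace_add, bilinTrace_add, bilinTrace_smul, bilinTrace_add, bilinTrace_flip, bilinTrace_zero, hB]
    simp

/-- A twice differentiable function touching a subharmonic function from above has nonnegative
Laplacian at the contact point: otherwise, on a small sphere, it lies below a harmonic quadratic
polynomial that is smaller at the centre. -/
theorem SubharmonicOn.bilinTrace_nonneg {u : Euc m → EReal} {U : Set (Euc m)} {ψ : Euc m → ℝ}
    (hu : SubharmonicOn u U) (hU : U ∈ 𝓝 x) (hψ : HasSecondFDerivAt ψ l B x)
    (hle : ∀ᶠ y in 𝓝 x, u y ≤ (ψ y : EReal)) (heq : (ψ x : EReal) ≤ u x) :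
    0 ≤ bilinTrace B := by
  by_contra! hneg
  have hm : 0 < (m : ℝ) := by
    rcases Nat.eq_zero_or_pos m with rfl | hm
    · simp [bilinTrace] at hneg
    · exact_mod_cast hm
  -- adding `c` times the inner product to `B` makes the trace vanish; on the sphere of radius `r`
  -- this raises the quadratic polynomial by `c r² / 2`, of which `c r² / 4` pays for the Taylor
  -- remainder and the other half is subtracted from the constant term
  set c : ℝ := -bilinTrace B / m with hc
  have hc0 : 0 < c := div_pos (neg_pos.2 hneg) hm
  let I : Euc m →L[ℝ] Euc m →L[ℝ] ℝ := innerSL ℝ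
  have hI : bilinTrace I = m := bilinTrace_innerSL
  have hQ : bilinTrace (B + c • I) = 0 := by
    rw [bilinTrace_add, bilinTrace_smul, hI, hc]
    field_simp
    ring
  have hI' : ∀ y, I y y = ‖y‖ ^ 2 := fun y => real_inner_self_eq_norm_sq y
  obtain ⟨δ, hδ, hT⟩ := hψ.taylor_bound (ε := c / 4) (by positivity)
  obtain ⟨δ', hδ', hN⟩ := Metric.eventually_nhds_iff.1 (hle.and hU)
  set r := min δ δ' / 2 with hr
  have hr0 : 0 < r := by positivity
  have hrδ : r < δ := by have := min_le_left δ δ'; rw [hr]; linarith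
  have hrδ' : r < δ' := by have := min_le_right δ δ'; rw [hr]; linarith
  have key := hu.le_of_harmonic x r hr0 (fun y hy => (hN (lt_of_le_of_lt hy hrδ')).2) _
    ((harmonicOnNhd_quadratic (ψ x - c / 4 * r ^ 2) l hQ x univ).mono (subset_univ _)
      |>.harmonicContOnCl) ?_ x (mem_ball_self hr0)
  · have h1 := heq.trans key
    simp only [sub_self, map_zero, add_zero, mul_zero, EReal.coe_le_coe_iff] at h1
    have : 0 < c / 4 * r ^ 2 := by positivity
    linarith
  · intro y hy
    rw [mem_sphere, dist_eq_norm] at hy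
    refine (hN (by rw [dist_eq_norm, hy]; exact hrδ')).1.trans (EReal.coe_le_coe_iff.2 ?_)
    have h2 := (abs_le.1 (hT (y - x) (by rw [hy]; exact hrδ))).2
    have h3 : (B + c • I) (y - x) (y - x) = B (y - x) (y - x) + c * r ^ 2 := by
      rw [← hy, ← hI']
      rfl
    rw [h3]
    rw [hy, add_sub_cancel] at h2
    linarith

/-- A real upper semicontinuous function is subharmonic as soon as every twice differentiable
function touching it from above has nonnegative Laplacian at the contact point. -/
theorem subharmonicOn_of_touching {v : Euc m → ℝ} {U : Set (Euc m)} (hm : 0 < m)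
    (husc : UpperSemicontinuousOn v U)
    (h : ∀ x ∈ U, ∀ (ψ : Euc m → ℝ) (l : Euc m →L[ℝ] ℝ) (B : Euc m →L[ℝ] Euc m →L[ℝ] ℝ),
      HasSecondFDerivAt ψ l B x → (∀ᶠ y in 𝓝 x, v y ≤ ψ y) → v x = ψ x → 0 ≤ bilinTrace B) :
    SubharmonicOn (fun x => (v x : EReal)) U := by
  refine ⟨fun x _ => EReal.coe_lt_top _, ?_, ?_⟩
  · exact continuous_coe_real_ereal.comp_upperSemicontinuousOn husc
      (fun _ _ => EReal.coe_le_coe_iff.2)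
  intro c r hr hcr φ hφ hle
  simp only [EReal.coe_le_coe_iff] at hle ⊢
  by_contra! hcon
  obtain ⟨y₀, hy₀, hlt⟩ := hcon
  -- a perturbation so small that it does not move the maximum to the boundary sphere
  set ε := (v y₀ - φ y₀) / (2 * r ^ 2) with hε
  have hε0 : 0 < ε := div_pos (sub_pos.2 hlt) (by positivity)
  have hεr : ε * r ^ 2 < v y₀ - φ y₀ := by
    rw [hε]
    field_simp
    linarith
  have hcont : ContinuousOn (fun y => -φ y + ε * ‖y - c‖ ^ 2) (closedBall c r) :=
    hφ.continuousOn_ball.neg.add (by fun_prop)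
  have hw : UpperSemicontinuousOn (fun y => v y + (-φ y + ε * ‖y - c‖ ^ 2)) (closedBall c r) :=
    (husc.mono hcr).add hcont.upperSemicontinuousOn
  obtain ⟨x, hx, hmax⟩ := hw.exists_isMaxOn ⟨y₀, ball_subset_closedBall hy₀⟩
    (isCompact_closedBall c r)
  have hmax' : ∀ y ∈ closedBall c r,
      v y + (-φ y + ε * ‖y - c‖ ^ 2) ≤ v x + (-φ x + ε * ‖x - c‖ ^ 2) := fun y hy => hmax hy
  have hxb : x ∈ ball c r := by
    by_contra hxb
    have hxs : x ∈ sphere c r := by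
      rw [← closedBall_sdiff_ball]
      exact ⟨hx, hxb⟩
    have h1 := hmax' y₀ (ball_subset_closedBall hy₀)
    have h2 := hle x hxs
    rw [mem_sphere, dist_eq_norm] at hxs
    rw [hxs] at h1
    have : 0 ≤ ε * ‖y₀ - c‖ ^ 2 := by positivity
    linarith
  obtain ⟨hφ2, hφΔ⟩ := hφ.harmonicOnNhd x hxb
  have hφ' := hφ2.hasSecondFDerivAt
  have htr := hφ'.laplacian_eq
  rw [hφΔ.self_of_nhds] at htr
  let I : Euc m →L[ℝ] Euc m →L[ℝ] ℝ := innerSL ℝ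
  have hI : bilinTrace I = m := bilinTrace_innerSL
  have hI' : ∀ y, I y y = ‖y‖ ^ 2 := fun y => real_inner_self_eq_norm_sq y
  have hψ := (hφ'.add ((HasSecondFDerivAt.bilin I c x).const_mul (-ε))).add
    (HasSecondFDerivAt.const (v x + (-φ x + ε * ‖x - c‖ ^ 2)) x)
  have h3 := h x (hcr hx) _ _ _ hψ ?_ ?_
  · simp only [bilinTrace_add, bilinTrace_smul, bilinTrace_flip, hI, ← htr] at h3
    have h5 : 0 < ε * m := mul_pos hε0 (by exact_mod_cast hm)
    simp only [Pi.zero_apply, bilinTrace_zero] at h3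
    linarith
  · filter_upwards [isOpen_ball.mem_nhds hxb] with y hy
    have := hmax' y (ball_subset_closedBall hy)
    simp only [hI']
    linarith
  · simp only [hI']
    ring

end

/-! ### Convex functions on the half-line -/

theorem ConvexOn.exists_subgradient {S : Set ℝ} {g : ℝ → ℝ} (hg : ConvexOn ℝ S g) {x : ℝ}
    (hx : x ∈ interior S) : ∃ p, ∀ y ∈ S, g x + p * (y - x) ≤ g y := by
  -- the right derivative is a subgradient
  refine ⟨derivWithin g (Ioi x) x, fun y hy => ?_⟩
  rcases lt_trichotomy y x with h | rfl | h
  · have h1 := (hg.slope_le_leftDeriv_of_mem_interior hy hx h).trans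
      (hg.leftDeriv_le_rightDeriv_of_mem_interior hx)
    rw [slope_def_field, div_le_iff₀ (sub_pos.2 h)] at h1
    linarith
  · simp
  · have h1 := hg.rightDeriv_le_slope_of_mem_interior hx hy h
    rw [slope_def_field, le_div_iff₀ (sub_pos.2 h)] at h1
    linarith

theorem ConvexOn.le_div_mul_of_zero {g : ℝ → ℝ} (hg : ConvexOn ℝ (Ici 0) g) (g0 : g 0 = 0)
    {s t : ℝ} (hs : 0 ≤ s) (hst : s ≤ t) (ht : 0 < t) : g s ≤ s / t * g t := by
  have h := hg.2 (mem_Ici.2 ht.le) self_mem_Ici (show 0 ≤ s / t by positivity)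
    (show 0 ≤ 1 - s / t from sub_nonneg.2 ((div_le_one ht).2 hst)) (by ring)
  simpa [g0, div_mul_cancel₀ s ht.ne'] using h

theorem ConvexOn.monotoneOn_of_nonneg {g : ℝ → ℝ} (hg : ConvexOn ℝ (Ici 0) g)
    (hnn : ∀ t, 0 ≤ t → 0 ≤ g t) (g0 : g 0 = 0) : MonotoneOn g (Ici 0) := by
  intro s hs t ht hst
  rcases (mem_Ici.1 ht).eq_or_lt with rfl | ht'
  · rw [le_antisymm hst hs]
  · exact (hg.le_div_mul_of_zero g0 hs hst ht').trans
      (mul_le_of_le_one_left (hnn t ht) ((div_le_one ht').2 hst))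

theorem ConvexOn.tendsto_zero_of_nonneg {g : ℝ → ℝ} (hg : ConvexOn ℝ (Ici 0) g)
    (hnn : ∀ t, 0 ≤ t → 0 ≤ g t) (g0 : g 0 = 0) : Tendsto g (𝓝[≥] 0) (𝓝 0) := by
  have h1 : Tendsto (fun t => t * g 1) (𝓝[≥] (0 : ℝ)) (𝓝 0) := by
    have : Tendsto (fun t => t * g 1) (𝓝 (0 : ℝ)) (𝓝 (0 * g 1)) :=
      (continuous_id.mul continuous_const).tendsto _
    rw [zero_mul] at this
    exact this.mono_left nhdsWithin_le_nhds
  refine tendsto_of_tendsto_of_tendsto_of_le_of_le' tendsto_const_nhds h1 ?_ ?_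
  · filter_upwards [self_mem_nhdsWithin] with t ht using hnn t ht
  · filter_upwards [self_mem_nhdsWithin, nhdsWithin_le_nhds (eventually_le_nhds zero_lt_one)]
      with t ht ht'
    simpa using hg.le_div_mul_of_zero g0 ht ht' one_pos

/-! ### Subspherical functions -/

section
variable {m : ℕ} {ρ : ℝ} {h : UnitSphere m → ℝ}

theorem homogExt_coe (ρ : ℝ) (h : UnitSphere m → ℝ) {x : Euc m} (hx : x ≠ 0) :
    homogExt ρ (fun s => (h s : EReal)) x = ((‖x‖ ^ ρ * h (sphereDir x hx) : ℝ) : EReal) := by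
  rw [homogExt, dif_neg hx, EReal.coe_mul]

theorem sphereDir_smul {x : Euc m} (hx : x ≠ 0) {c : ℝ} (hc : 0 < c) (hcx : c • x ≠ 0) :
    sphereDir (c • x) hcx = sphereDir x hx := by
  apply Subtype.ext
  simp only [sphereDir, norm_smul, Real.norm_of_nonneg hc.le, smul_smul]
  congr 1
  field_simp

theorem sphereDir_coe (s : UnitSphere m) (hs : (s : Euc m) ≠ 0) : sphereDir (s : Euc m) hs = s := by
  apply Subtype.ext
  simp [sphereDir]

/-- A real-valued subspherical function is either constant (order zero), or has a subharmonic
homogeneous extension. -/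
theorem IsSubspherical.const_or_subharmonicOn [Nonempty (UnitSphere m)]
    (hh : IsSubspherical ρ (fun s => (h s : EReal))) :
    (ρ = 0 ∧ ∀ s t, h s = h t) ∨
      (0 < ρ ∧ SubharmonicOn (homogExt ρ (fun s => (h s : EReal))) univ) := by
  rcases hh with ⟨hρ, c, -, hc⟩ | ⟨hρ, hbot | hsub⟩
  · exact Or.inl ⟨hρ, fun s t => EReal.coe_injective ((hc s).trans (hc t).symm)⟩
  · exact absurd (hbot (Classical.arbitrary _)) (EReal.coe_ne_bot _)
  · exact Or.inr ⟨hρ, hsub⟩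

theorem IsSubspherical.upperSemicontinuous [Nonempty (UnitSphere m)]
    (hh : IsSubspherical ρ (fun s => (h s : EReal))) : UpperSemicontinuous h := by
  rcases hh.const_or_subharmonicOn with ⟨-, hc⟩ | ⟨-, hsub⟩
  · intro s y hy
    exact Eventually.of_forall fun t => (hc t s).trans_lt hy
  · intro s y hy
    have hne : ∀ t : UnitSphere m, (t : Euc m) ≠ 0 := fun t => ne_zero_of_mem_unit_sphere t
    have hH : ∀ t : UnitSphere m, homogExt ρ (fun s => (h s : EReal)) t = h t := fun t => by
      rw [homogExt_coe ρ h (hne t), sphereDir_coe, norm_eq_of_mem_sphere t, Real.one_rpow, one_mul]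
    have h1 := hsub.usc s (mem_univ _) y (by simpa only [hH, EReal.coe_lt_coe_iff] using hy)
    rw [nhdsWithin_univ] at h1
    filter_upwards [continuous_subtype_val.continuousAt.eventually h1] with t ht
    rw [hH] at ht
    exact_mod_cast ht

theorem radialTest_of_ne (g : ℝ → ℝ) (h : UnitSphere m → ℝ) {x : Euc m} (hx : x ≠ 0) :
    radialTest g h x = g (1 / ‖x‖ ^ (m - 1) - 1) * h (sphereDir x hx) := dif_neg hx

theorem norm_rpow_one_sub (hm : 1 ≤ m) (x : Euc m) :
    1 / ‖x‖ ^ (m - 1) = ‖x‖ ^ (1 - (m : ℝ)) := by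
  rw [show 1 - (m : ℝ) = -((m - 1 : ℕ) : ℝ) by push_cast [hm]; ring,
    Real.rpow_neg (norm_nonneg x), Real.rpow_natCast, one_div]

theorem one_div_norm_pow_sub_one_nonneg {x : Euc m} (hx : x ≠ 0) (hx1 : ‖x‖ ≤ 1) :
    0 ≤ 1 / ‖x‖ ^ (m - 1) - 1 := by
  rw [sub_nonneg, one_le_div (by positivity)]
  exact pow_le_one₀ (norm_nonneg x) hx1

theorem one_div_norm_pow_sub_one_pos (hm : 2 ≤ m) {x : Euc m} (hx : x ≠ 0) (hx1 : ‖x‖ < 1) :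
    0 < 1 / ‖x‖ ^ (m - 1) - 1 := by
  rw [sub_pos, one_lt_div (by positivity)]
  exact pow_lt_one₀ (norm_nonneg x) hx1 (by omega)

/-- The product of a continuous nonnegative radial factor and an upper semicontinuous nonnegative
spherical factor is upper semicontinuous. -/
theorem upperSemicontinuousOn_radialTest (hm : 2 ≤ m) {g : ℝ → ℝ}
    (gconv : ConvexOn ℝ (Ici 0) g) (gnonneg : ∀ t, 0 ≤ t → 0 ≤ g t)
    (husc : UpperSemicontinuous h) (hnonneg : ∀ s, 0 ≤ h s) {U : Set (Euc m)}
    (hU : ∀ x ∈ U, x ≠ 0 ∧ ‖x‖ < 1) : UpperSemicontinuousOn (radialTest g h) U := by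
  intro x hx y hy
  obtain ⟨hx0, hx1⟩ := hU x hx
  rw [radialTest_of_ne g h hx0] at hy
  set t₀ := 1 / ‖x‖ ^ (m - 1) - 1 with ht₀
  have ht₀pos : 0 < t₀ := one_div_norm_pow_sub_one_pos hm hx0 hx1
  -- bounds `a > g t₀` and `b > h` at the point, still with `a * b < y`
  have hcont : Tendsto (fun ε : ℝ => (g t₀ + ε) * (h (sphereDir x hx0) + ε)) (𝓝[>] 0)
      (𝓝 (g t₀ * h (sphereDir x hx0))) := by
    have : Continuous fun ε : ℝ => (g t₀ + ε) * (h (sphereDir x hx0) + ε) := by fun_prop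
    have h2 := this.tendsto 0
    simp only [add_zero] at h2
    exact h2.mono_left nhdsWithin_le_nhds
  obtain ⟨ε, hε, hε0⟩ := ((hcont.eventually (eventually_lt_nhds hy)).and
    self_mem_nhdsWithin).exists
  have hT : ContinuousAt (fun z : Euc m => 1 / ‖z‖ ^ (m - 1) - 1) x :=
    ((continuousAt_const.div (by fun_prop) (by positivity)).sub continuousAt_const)
  have hg : ContinuousAt g t₀ := by
    have := gconv.continuousOn_interior
    rw [interior_Ici] at this
    exact this.continuousAt (Ioi_mem_nhds ht₀pos)
  have h1 : ∀ᶠ z in 𝓝 x, g (1 / ‖z‖ ^ (m - 1) - 1) < g t₀ + ε :=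
    (hg.tendsto.comp hT.tendsto).eventually (eventually_lt_nhds (lt_add_of_pos_right _ hε0))
  obtain ⟨V, hV, hVh⟩ := _root_.eventually_nhds_iff.1
    (husc (sphereDir x hx0) _ (lt_add_of_pos_right _ hε0))
  have hdir : ContinuousAt (fun z : Euc m => ‖z‖⁻¹ • z) x :=
    ((continuous_norm.continuousAt).inv₀ (norm_ne_zero_iff.2 hx0)).smul continuousAt_id
  obtain ⟨W, hWo, rfl⟩ := isOpen_induced_iff.1 hVh.1
  have h2 : ∀ᶠ z in 𝓝 x, ‖z‖⁻¹ • z ∈ W := hdir.eventually (hWo.mem_nhds hVh.2)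
  have h3 : ∀ᶠ z in 𝓝 x, 0 < 1 / ‖z‖ ^ (m - 1) - 1 := hT.eventually (eventually_gt_nhds ht₀pos)
  filter_upwards [nhdsWithin_le_nhds h1, nhdsWithin_le_nhds h2, nhdsWithin_le_nhds h3,
    nhdsWithin_le_nhds (eventually_ne_nhds hx0)] with z hz1 hz2 hz3 hz4
  rw [radialTest_of_ne g h hz4]
  refine lt_of_le_of_lt ?_ hε
  exact mul_le_mul hz1.le (hV (sphereDir z hz4) hz2).le (hnonneg _)
    (add_nonneg (gnonneg _ ht₀pos.le) hε0.le)

end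

/-! ### The differential inequality -/

section
variable {m : ℕ} {ρ : ℝ} {h : UnitSphere m → ℝ} {l : Euc m →L[ℝ] ℝ}
  {B : Euc m →L[ℝ] Euc m →L[ℝ] ℝ} {x : Euc m}

theorem ContDiffAt.exists_hasSecondFDerivAt_comp_norm_sq {α : ℝ → ℝ}
    (hα : ContDiffAt ℝ 2 α (‖x‖ ^ 2)) :
    ∃ (c : ℝ) (C : _), HasSecondFDerivAt (fun y => α (‖y‖ ^ 2)) (c • innerSL ℝ x) C x := by
  have h1 : ∀ᶠ s in 𝓝 (‖x‖ ^ 2), HasDerivAt α (deriv α s) s := by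
    filter_upwards [hα.eventually (by simp)] with s hs
    exact (hs.differentiableAt (by simp)).hasDerivAt
  have h2 : DifferentiableAt ℝ (deriv α) (‖x‖ ^ 2) := by
    have h3 := (hα.fderiv_right (m := 1) (by norm_num)).differentiableAt (by simp)
    exact h3.clm_apply (differentiableAt_const (1 : ℝ))
  obtain ⟨C, hC, -⟩ := HasSecondFDerivAt.comp_norm_sq h1 h2.hasDerivAt
  exact ⟨_, C, hC⟩

/-- If `w` vanishes at `x` and is nonnegative near `x` on the ray through `x`, then its derivative
at `x` in the direction `x` vanishes. -/
theorem HasFDerivAt.radial_eq_zero {w : Euc m → ℝ} (hw : HasFDerivAt w l x) (hw0 : w x = 0)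
    (hray : ∀ᶠ t : ℝ in 𝓝 1, 0 ≤ w (t • x)) : l x = 0 := by
  have hγ : HasDerivAt (fun t : ℝ => t • x) x 1 := by
    simpa using (hasDerivAt_id (1 : ℝ)).smul_const x
  have hw' : HasFDerivAt w l ((1 : ℝ) • x) := by rwa [one_smul]
  have hd : HasDerivAt (fun t : ℝ => w (t • x)) (l x) 1 := hw'.comp_hasDerivAt 1 hγ
  have hmin : IsLocalMin (fun t : ℝ => w (t • x)) 1 := by
    filter_upwards [hray] with t ht
    simpa [hw0] using ht
  exact hmin.hasDerivAt_eq_zero hd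

/-- The comparison principle in the radial variable. Let `F = c + p ‖·‖^(1-m)` be positive at
`x`, let `ψ ≥ F h` near `x` with equality at `x`. If `H = ‖·‖^ρ h` is subharmonic, then
`‖·‖^ρ / F * ψ` touches `H` from above at `x`. Since the radial derivatives of `ψ` and `F h`
agree at `x`, nothing is lost: `Δψ ≥ h (ΔF - ρ (ρ + m - 2) ‖x‖⁻² F)` at `x`. -/
theorem bilinTrace_ge_of_touching (hx : x ≠ 0)
    (hsub : SubharmonicOn (homogExt ρ (fun s => (h s : EReal))) univ) {c p : ℝ}
    (hF : 0 < c + p * ‖x‖ ^ (1 - (m : ℝ))) {ψ : Euc m → ℝ} (hψ : HasSecondFDerivAt ψ l B x)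
    (hle : ∀ᶠ y in 𝓝 x, ∀ hy : y ≠ 0,
      (c + p * ‖y‖ ^ (1 - (m : ℝ))) * h (sphereDir y hy) ≤ ψ y)
    (heq : ψ x = (c + p * ‖x‖ ^ (1 - (m : ℝ))) * h (sphereDir x hx)) :
    h (sphereDir x hx) * (p * (m - 1) * ‖x‖ ^ (1 - (m : ℝ)) -
      ρ * (ρ + m - 2) * (c + p * ‖x‖ ^ (1 - (m : ℝ)))) ≤ ‖x‖ ^ 2 * bilinTrace B := by
  have hx0 : 0 < ‖x‖ := norm_pos_iff.2 hx
  set h₀ := h (sphereDir x hx) with hh₀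
  set F : Euc m → ℝ := fun y => c + p * ‖y‖ ^ (1 - (m : ℝ)) with hFdef
  change 0 < F x at hF
  obtain ⟨a, C, hC, hCtr⟩ := HasSecondFDerivAt.norm_rpow (1 - (m : ℝ)) hx
  have hF2 := (HasSecondFDerivAt.const c x).add (hC.const_mul p)
  have hFcont : ContinuousAt F x := hF2.hasFDerivAt.continuousAt
  have hFpos : ∀ᶠ y in 𝓝 x, 0 < F y := hFcont.eventually (eventually_gt_nhds hF)
  -- `w = ψ - h₀ F` vanishes at `x` together with its radial derivative
  have hw := hψ.add (hF2.const_mul (-h₀))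
  have hw0 : ψ x + -h₀ * F x = 0 := by rw [heq]; ring
  have hrad := hw.hasFDerivAt.radial_eq_zero hw0 (by
    have hc : Tendsto (fun t : ℝ => t • x) (𝓝 1) (𝓝 x) := by
      have : Continuous fun t : ℝ => t • x := by fun_prop
      simpa using this.tendsto 1
    filter_upwards [hc.eventually hle, eventually_gt_nhds zero_lt_one] with t ht ht0
    have hne : t • x ≠ 0 := smul_ne_zero ht0.ne' hx
    have := ht hne
    rw [sphereDir_smul hx ht0 hne, ← hh₀] at this
    linarith)
  -- the radial factor `A = ‖·‖^ρ / F`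
  obtain ⟨b, D, hD⟩ : ∃ (b : ℝ) (D : _),
      HasSecondFDerivAt (fun y => ‖y‖ ^ ρ / F y) (b • innerSL ℝ x) D x := by
    have hs : ‖x‖ ^ 2 ≠ 0 := by positivity
    have hα : ContDiffAt ℝ 2 (fun s : ℝ => s ^ (ρ / 2) / (c + p * s ^ ((1 - (m : ℝ)) / 2)))
        (‖x‖ ^ 2) := by
      refine ContDiffAt.div (Real.contDiffAt_rpow_const_of_ne hs)
        (contDiffAt_const.add (contDiffAt_const.mul (Real.contDiffAt_rpow_const_of_ne hs))) ?_
      rw [norm_sq_rpow_half]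
      exact hF.ne'
    obtain ⟨b, D, hD⟩ := hα.exists_hasSecondFDerivAt_comp_norm_sq
    simp only [norm_sq_rpow_half] at hD
    exact ⟨b, D, hD⟩
  obtain ⟨a', E, hE, hEtr⟩ := HasSecondFDerivAt.norm_rpow ρ hx
  have hΨ := (hD.mul hw).add (hE.const_mul h₀)
  have key := hsub.bilinTrace_nonneg univ_mem hΨ ?_ ?_
  · have hw0' : ψ x + -h₀ * (c + p * ‖x‖ ^ (1 - (m : ℝ))) = 0 := hw0
    simp only [bilinTrace_add, bilinTrace_smul, hCtr, hEtr, hw0'] at key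
    have hcross : ∀ k : Euc m →L[ℝ] ℝ, k x = 0 → bilinTrace (k.smulRight (b • innerSL ℝ x)) = 0 ∧
        bilinTrace ((b • innerSL ℝ x : Euc m →L[ℝ] ℝ).smulRight k) = 0 := fun k hk => by
      have : (b • innerSL ℝ x : Euc m →L[ℝ] ℝ).smulRight k = b • (innerSL ℝ x).smulRight k := by
        ext u v
        simp [mul_assoc]
      rw [bilinTrace_smulRight_comm, and_self, this, bilinTrace_smul,
        bilinTrace_smulRight_innerSL_left, hk, mul_zero]
    rw [(hcross _ hrad).1, (hcross _ hrad).2] at key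
    have e1 : ‖x‖ ^ (1 - (m : ℝ) - 2) = ‖x‖ ^ (1 - (m : ℝ)) / ‖x‖ ^ 2 := by
      rw [Real.rpow_sub hx0, Real.rpow_two]
    have e2 : ‖x‖ ^ (ρ - 2) = ‖x‖ ^ ρ / ‖x‖ ^ 2 := by
      rw [Real.rpow_sub hx0, Real.rpow_two]
    rw [bilinTrace_zero, e1, e2] at key
    have hρ0 : 0 < ‖x‖ ^ ρ := Real.rpow_pos_of_pos hx0 ρ
    have hfac : 0 ≤ ‖x‖ ^ ρ / (F x * ‖x‖ ^ 2) * (‖x‖ ^ 2 * bilinTrace B -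
        h₀ * (p * (m - 1) * ‖x‖ ^ (1 - (m : ℝ)) - ρ * (ρ + m - 2) * F x)) := by
      refine key.trans_eq ?_
      field_simp
      ring
    have := nonneg_of_mul_nonneg_right hfac (by positivity)
    linarith
  · filter_upwards [hle, hFpos, eventually_ne_nhds hx] with y hy hyF hy0
    rw [homogExt_coe ρ h hy0, EReal.coe_le_coe_iff]
    have h1 : ‖y‖ ^ ρ / F y * (F y * h (sphereDir y hy0)) ≤ ‖y‖ ^ ρ / F y * ψ y :=
      mul_le_mul_of_nonneg_left (hy hy0) (by positivity)
    have h2 : ‖y‖ ^ ρ / F y * (ψ y + -h₀ * F y) + h₀ * ‖y‖ ^ ρ = ‖y‖ ^ ρ / F y * ψ y := by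
      field_simp
      ring
    have h3 : ‖y‖ ^ ρ / F y * (F y * h (sphereDir y hy0)) = ‖y‖ ^ ρ * h (sphereDir y hy0) := by
      field_simp
    change _ ≤ ‖y‖ ^ ρ / F y * (ψ y + -h₀ * F y) + h₀ * ‖y‖ ^ ρ
    linarith
  · rw [homogExt_coe ρ h hx, EReal.coe_le_coe_iff]
    change ‖x‖ ^ ρ / F x * (ψ x + -h₀ * F x) + h₀ * ‖x‖ ^ ρ ≤ _
    rw [hw0, mul_zero, zero_add, mul_comm]

/-- Functions touching `g(‖·‖^(1-m) - 1) h` from above have nonnegative Laplacian at the contact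
point, provided the radial inequality `hK` holds there. At the contact point `g` is replaced by an
affine minorant `g t₀ + p (t - t₀)`, for which `g t₀ ≤ p t₀` because `g 0 = 0`. -/
theorem bilinTrace_nonneg_of_touching_radialTest (hm : 2 ≤ m) [Nonempty (UnitSphere m)]
    (hsub : IsSubspherical ρ (fun s => (h s : EReal))) (hnonneg : ∀ s, 0 ≤ h s)
    {g : ℝ → ℝ} (gconv : ConvexOn ℝ (Ici 0) g) (gnonneg : ∀ t, 0 ≤ t → 0 ≤ g t) (gzero : g 0 = 0)
    (hx : x ≠ 0) (hx1 : ‖x‖ < 1)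
    (hK : ρ * (ρ + m - 2) * (1 / ‖x‖ ^ (m - 1) - 1) ≤ (m - 1) * (1 / ‖x‖ ^ (m - 1)))
    {ψ : Euc m → ℝ} (hψ : HasSecondFDerivAt ψ l B x)
    (hle : ∀ᶠ y in 𝓝 x, radialTest g h y ≤ ψ y) (heq : radialTest g h x = ψ x) :
    0 ≤ bilinTrace B := by
  have hx0 : 0 < ‖x‖ := norm_pos_iff.2 hx
  have hm' : (2 : ℝ) ≤ m := by exact_mod_cast hm
  have hm1 : 0 ≤ (m : ℝ) - 1 := by linarith
  have ht₀ : 0 < 1 / ‖x‖ ^ (m - 1) - 1 := one_div_norm_pow_sub_one_pos hm hx hx1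
  have hpow := fun y : Euc m => norm_rpow_one_sub (by omega : 1 ≤ m) y
  obtain ⟨p, hp⟩ := gconv.exists_subgradient (x := 1 / ‖x‖ ^ (m - 1) - 1)
    (by rw [interior_Ici]; exact ht₀)
  have hp0 : g (1 / ‖x‖ ^ (m - 1) - 1) ≤ p * (1 / ‖x‖ ^ (m - 1) - 1) := by
    have := hp 0 self_mem_Ici
    rw [gzero] at this
    linarith
  have hppos : 0 ≤ p := nonneg_of_mul_nonneg_left ((gnonneg _ ht₀.le).trans hp0) ht₀
  -- near `x` the function `ψ` dominates the affine minorant times `h`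
  set c : ℝ := g (1 / ‖x‖ ^ (m - 1) - 1) - p * (1 / ‖x‖ ^ (m - 1)) with hc
  have hnear : ∀ᶠ y in 𝓝 x, y ≠ 0 ∧ ‖y‖ < 1 :=
    (eventually_ne_nhds hx).and (continuous_norm.continuousAt.eventually (eventually_lt_nhds hx1))
  have hle' : ∀ᶠ y in 𝓝 x, ∀ hy : y ≠ 0,
      (c + p * ‖y‖ ^ (1 - (m : ℝ))) * h (sphereDir y hy) ≤ ψ y := by
    filter_upwards [hle, hnear] with y hy hyn hy0
    rw [radialTest_of_ne g h hy0] at hy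
    refine le_trans (mul_le_mul_of_nonneg_right ?_ (hnonneg _)) hy
    have := hp _ (mem_Ici.2 (one_div_norm_pow_sub_one_nonneg hy0 hyn.2.le))
    rw [← hpow, hc]
    linarith
  have hFx : c + p * ‖x‖ ^ (1 - (m : ℝ)) = g (1 / ‖x‖ ^ (m - 1) - 1) := by
    rw [← hpow, hc]
    ring
  have heq' : ψ x = (c + p * ‖x‖ ^ (1 - (m : ℝ))) * h (sphereDir x hx) := by
    rw [hFx, ← heq, radialTest_of_ne g h hx]
  rcases hsub.const_or_subharmonicOn with ⟨-, hconst⟩ | ⟨hρ, hH⟩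
  · -- `h` is constant: `ψ - h F` has a local minimum, and `F` is subharmonic
    obtain ⟨a, C, hC, hCtr⟩ := HasSecondFDerivAt.norm_rpow (1 - (m : ℝ)) hx
    have hw := hψ.add (((HasSecondFDerivAt.const c x).add (hC.const_mul p)).const_mul
      (-h (sphereDir x hx)))
    have h1 := hw.bilinTrace_nonneg_of_isLocalMin (by
      filter_upwards [hle', hnear] with y hy hyn
      have h2 := hy hyn.1
      rw [hconst _ (sphereDir x hx)] at h2
      rw [heq']
      linarith)
    simp only [bilinTrace_add, bilinTrace_smul, hCtr, bilinTrace_zero] at h1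
    have h3 : 0 ≤ h (sphereDir x hx) * (p * (((m : ℝ) - 1) * ‖x‖ ^ (1 - (m : ℝ) - 2))) :=
      mul_nonneg (hnonneg _) (mul_nonneg hppos (mul_nonneg hm1 (Real.rpow_nonneg hx0.le _)))
    linarith
  rcases (gnonneg _ ht₀.le).eq_or_lt with hg0 | hgpos
  · -- the product vanishes at `x`, which is then a local minimum of `ψ`
    refine hψ.bilinTrace_nonneg_of_isLocalMin ?_
    filter_upwards [hle, hnear] with y hy hyn
    rw [heq', hFx, ← hg0, zero_mul]
    refine le_trans ?_ hy
    rw [radialTest_of_ne g h hyn.1]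
    exact mul_nonneg (gnonneg _ (one_div_norm_pow_sub_one_nonneg hyn.1 hyn.2.le)) (hnonneg _)
  · have h1 := bilinTrace_ge_of_touching hx hH (by rw [hFx]; exact hgpos) hψ hle' heq'
    rw [hFx, ← hpow] at h1
    have hKpos : 0 ≤ ρ * (ρ + m - 2) := mul_nonneg hρ.le (by linarith)
    have h2 : ρ * (ρ + m - 2) * g (1 / ‖x‖ ^ (m - 1) - 1) ≤ p * (m - 1) * (1 / ‖x‖ ^ (m - 1)) := by
      have h3 := mul_le_mul_of_nonneg_left hp0 hKpos
      have h4 := mul_le_mul_of_nonneg_left hK hppos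
      linarith
    have h5 := (mul_nonneg (hnonneg (sphereDir x hx)) (sub_nonneg.2 h2)).trans h1
    exact nonneg_of_mul_nonneg_right h5 (by positivity)

/-! ### The critical radius -/

theorem half_le_critRadius (m : ℕ) (ρ : ℝ) : 1 / 2 ≤ critRadius m ρ := by
  rw [critRadius]
  split_ifs
  · exact le_rfl
  · exact le_max_left _ _

theorem critRadius_lt_one (hm : 2 ≤ m) (hρ : 0 ≤ ρ) : critRadius m ρ < 1 := by
  have hm' : (2 : ℝ) ≤ m := by exact_mod_cast hm
  rw [critRadius]
  split_ifs with h0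
  · norm_num
  · have hρ' : 0 < ρ := hρ.lt_of_ne' h0
    refine max_lt (by norm_num) (Real.rpow_lt_one (le_max_left _ _) (max_lt one_pos ?_) ?_)
    · have : 0 < ((m : ℝ) - 1) / (ρ * (ρ + m - 2)) :=
        div_pos (by linarith) (mul_pos hρ' (by linarith))
      linarith
    · exact one_div_pos.2 (by linarith)

/-- Beyond the critical radius the radial part of the Laplacian compensates the spherical part. -/
theorem radial_inequality_of_critRadius_le (hm : 2 ≤ m) (hρ : 0 ≤ ρ) {r : ℝ}
    (hr : critRadius m ρ ≤ r) :
    ρ * (ρ + m - 2) * (1 / r ^ (m - 1) - 1) ≤ (m - 1) * (1 / r ^ (m - 1)) := by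
  have hm' : (2 : ℝ) ≤ m := by exact_mod_cast hm
  have hr0 : 0 < r := by linarith [half_le_critRadius m ρ]
  have hrp : 0 < r ^ (m - 1) := by positivity
  suffices h : ρ * (ρ + m - 2) * (1 - r ^ (m - 1)) ≤ m - 1 by
    have h1 := mul_le_mul_of_nonneg_right h (one_div_pos.2 hrp).le
    calc _ = ρ * (ρ + m - 2) * (1 - r ^ (m - 1)) * (1 / r ^ (m - 1)) := by field_simp
      _ ≤ _ := h1
  rcases hρ.eq_or_lt with rfl | hρ'
  · linarith
  have hKpos : 0 < ρ * (ρ + m - 2) := mul_pos hρ' (by linarith)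
  rw [critRadius, if_neg hρ'.ne'] at hr
  have h1 := Real.rpow_le_rpow (Real.rpow_nonneg (le_max_left _ _) _)
    ((le_max_right _ _).trans hr) (by linarith : 0 ≤ (m : ℝ) - 1)
  rw [← Real.rpow_mul (le_max_left _ _), one_div_mul_cancel (by linarith), Real.rpow_one,
    show (m : ℝ) - 1 = ((m - 1 : ℕ) : ℝ) by push_cast [show 1 ≤ m by omega]; ring,
    Real.rpow_natCast] at h1
  have h2 := (le_max_right _ _).trans h1
  rw [show ((m - 1 : ℕ) : ℝ) = (m : ℝ) - 1 by push_cast [show 1 ≤ m by omega]; ring, sub_le_comm,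
    le_div_iff₀ hKpos] at h2
  linarith

/-! ### Boundary values and the test class -/

/-- The radial factor tends to zero at the unit sphere, and the spherical factor is bounded. -/
theorem tendsto_radialTest_zero {g : ℝ → ℝ} (gconv : ConvexOn ℝ (Ici 0) g)
    (gnonneg : ∀ t, 0 ≤ t → 0 ≤ g t) (gzero : g 0 = 0) (hnonneg : ∀ s, 0 ≤ h s) {M : ℝ}
    (hM : ∀ s, h s ≤ M) {U : Set (Euc m)} (hU : ∀ y ∈ U, y ≠ 0 ∧ ‖y‖ < 1) (hx : ‖x‖ = 1) :
    Tendsto (radialTest g h) (𝓝[U] x) (𝓝 0) := by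
  have hT : Tendsto (fun y : Euc m => 1 / ‖y‖ ^ (m - 1) - 1) (𝓝[U] x) (𝓝[≥] 0) := by
    refine tendsto_nhdsWithin_iff.2 ⟨?_, ?_⟩
    · have hc : ContinuousAt (fun y : Euc m => 1 / ‖y‖ ^ (m - 1) - 1) x :=
        (continuousAt_const.div (by fun_prop) (by rw [hx]; simp)).sub continuousAt_const
      have h1 := hc.tendsto
      simp only [hx, one_pow, div_one, sub_self] at h1
      exact h1.mono_left nhdsWithin_le_nhds
    · filter_upwards [self_mem_nhdsWithin] with y hy
      exact one_div_norm_pow_sub_one_nonneg (hU y hy).1 (hU y hy).2.le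
  have h2 := ((gconv.tendsto_zero_of_nonneg gnonneg gzero).comp hT).mul_const M
  rw [zero_mul] at h2
  refine tendsto_of_tendsto_of_tendsto_of_le_of_le' tendsto_const_nhds h2 ?_ ?_ <;>
  filter_upwards [self_mem_nhdsWithin] with y hy <;>
  obtain ⟨hy0, hy1⟩ := hU y hy <;>
  have hg := gnonneg _ (one_div_norm_pow_sub_one_nonneg hy0 hy1.le) <;>
  rw [radialTest_of_ne g h hy0]
  · exact mul_nonneg hg (hnonneg _)
  · exact mul_le_mul_of_nonneg_left (hM _) hg

end

theorem mainTheorem3 (m : ℕ) (hm : 2 ≤ m) (ρ : ℝ) (hρ : 0 ≤ ρ)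
    (h : UnitSphere m → ℝ) (hsub : IsSubspherical ρ (fun s => (h s : EReal)))
    (hnonneg : ∀ s, 0 ≤ h s)
    (g : ℝ → ℝ) (gconv : ConvexOn ℝ (Set.Ici 0) g) (gnonneg : ∀ t, 0 ≤ t → 0 ≤ g t)
    (gzero : g 0 = 0) :
    (1 / 2 ≤ critRadius m ρ ∧ critRadius m ρ < 1) ∧
    ∃ M : ℝ, IsGreatest (Set.range h) M ∧
      IsSubharmonicTest (Metric.ball (0 : Euc m) 1) (Metric.closedBall (0 : Euc m) (critRadius m ρ))
        (g (1 / critRadius m ρ ^ (m - 1) - 1) * M) (radialTest g h) := by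
  have hlo := half_le_critRadius m ρ
  have hhi := critRadius_lt_one hm hρ
  refine ⟨⟨hlo, hhi⟩, ?_⟩
  have : Nonempty (Fin m) := ⟨⟨0, by omega⟩⟩
  have : Nonempty (UnitSphere m) := (NormedSpace.sphere_nonempty.2 zero_le_one).to_subtype
  have husc := hsub.upperSemicontinuous
  obtain ⟨s₀, -, hs₀⟩ := (upperSemicontinuousOn_univ_iff.2 husc).exists_isMaxOn univ_nonempty
    isCompact_univ
  have hmax : ∀ s, h s ≤ h s₀ := fun s => hs₀ (mem_univ s)
  have hU : ∀ x ∈ ball (0 : Euc m) 1 \ closedBall 0 (critRadius m ρ),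
      critRadius m ρ < ‖x‖ ∧ x ≠ 0 ∧ ‖x‖ < 1 := by
    intro x hx
    have h1 : critRadius m ρ < ‖x‖ := by simpa using hx.2
    exact ⟨h1, norm_pos_iff.1 (by linarith), by simpa using hx.1⟩
  refine ⟨h s₀, ⟨mem_range_self _, forall_mem_range.2 hmax⟩, ?_, ?_, ?_, ?_⟩
  · refine subharmonicOn_of_touching (by omega)
      (upperSemicontinuousOn_radialTest hm gconv gnonneg husc hnonneg fun x hx => (hU x hx).2) ?_
    intro x hx ψ l B hψ hle heq
    obtain ⟨hxr, hx0, hx1⟩ := hU x hx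
    exact bilinTrace_nonneg_of_touching_radialTest hm hsub hnonneg gconv gnonneg gzero hx0 hx1
      (radial_inequality_of_critRadius_le hm hρ hxr.le) hψ hle heq
  · intro x hx
    obtain ⟨-, hx0, hx1⟩ := hU x hx
    rw [radialTest_of_ne g h hx0]
    exact mul_nonneg (gnonneg _ (one_div_norm_pow_sub_one_nonneg hx0 hx1.le)) (hnonneg _)
  · intro z hz
    rw [frontier_ball 0 one_ne_zero, mem_sphere_zero_iff_norm] at hz
    exact tendsto_radialTest_zero gconv gnonneg gzero hnonneg hmax (fun x hx => (hU x hx).2) hz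
  · intro x hx
    obtain ⟨hxr, hx0, hx1⟩ := hU x hx
    have hT := one_div_norm_pow_sub_one_nonneg hx0 hx1.le
    have hle : 1 / ‖x‖ ^ (m - 1) - 1 ≤ 1 / critRadius m ρ ^ (m - 1) - 1 :=
      sub_le_sub_right (one_div_le_one_div_of_le (by positivity)
        (pow_le_pow_left₀ (by linarith) hxr.le _)) 1
    rw [radialTest_of_ne g h hx0]
    exact mul_le_mul (gconv.monotoneOn_of_nonneg gnonneg gzero hT (hT.trans hle) hle) (hmax _)
      (hnonneg _) (gnonneg _ (hT.trans hle))
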